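/- Let $H$ be an infinite-dimensional complex Hilbert space and let $T$ be a bounded linear operator on $H$ with $T^2=T$. Write $R(T)$ and $N(T)$ for the range and the null space of $T$. A bounded operator $S$ on $H$ is called absolutely norm attaining, $S\in\mathcal{AN}(H)$, if for every nonzero closed subspace $M$ of $H$ there is a unit vector $x\in M$ with $\|Sx\|=\|S|_M\|$; it is called absolutely minimum attaining, $S\in\mathcal{AM}(H)$, if for every nonzero closed subspace $M$ of $H$ there is a unit vector $x\in M$ with $\|Sx\|=\inf\{\|Sy\| : y\in M,\ \|y\|=1\}$. Then the following are equivalent: (i) $T\in\mathcal{AN}(H)$; (ii) $R(T)$ or $N(T)$ is finite-dimensional; (iii) $T\in\mathcal{AM}(H)$; (iv) $T$ belongs to the closure $\overline{\mathcal{AN}(H)}$ of $\mathcal{AN}(H)$ in the operator norm. -/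

import Mathlib

/-- A bounded operator is norm attaining if `‖T x‖ = ‖T‖` for some unit vector `x`. -/
def IsNormAttaining {E F : Type*} [NormedAddCommGroup E] [InnerProductSpace ℂ E]
    [NormedAddCommGroup F] [InnerProductSpace ℂ F] (T : E →L[ℂ] F) : Prop :=
  ∃ x : E, ‖x‖ = 1 ∧ ‖T x‖ = ‖T‖

/-- The minimum modulus `m(T) = inf {‖T x‖ : ‖x‖ = 1}` (meaningful for `E ≠ 0`, where the set is
nonempty and bounded below by `0`). -/
noncomputable def minimumModulus {E F : Type*} [NormedAddCommGroup E] [InnerProductSpace ℂ E]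
    [NormedAddCommGroup F] [InnerProductSpace ℂ F] (T : E →L[ℂ] F) : ℝ :=
  sInf {r : ℝ | ∃ x : E, ‖x‖ = 1 ∧ ‖T x‖ = r}

/-- A bounded operator is minimum attaining if `‖T x‖ = m(T)` for some unit vector `x`. -/
def IsMinimumAttaining {E F : Type*} [NormedAddCommGroup E] [InnerProductSpace ℂ E]
    [NormedAddCommGroup F] [InnerProductSpace ℂ F] (T : E →L[ℂ] F) : Prop :=
  ∃ x : E, ‖x‖ = 1 ∧ ‖T x‖ = minimumModulus T

/-- The class `AN(E, F)` of absolutely norm attaining operators: the restriction of `T` to every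
nonzero closed subspace `M` (including `M = E`) is norm attaining. -/
def absolutelyNormAttaining (E F : Type*) [NormedAddCommGroup E] [InnerProductSpace ℂ E]
    [NormedAddCommGroup F] [InnerProductSpace ℂ F] : Set (E →L[ℂ] F) :=
  {T | ∀ M : Submodule ℂ E, IsClosed (M : Set E) → M ≠ ⊥ → IsNormAttaining (T.comp M.subtypeL)}

/-- The class `AM(E, F)` of absolutely minimum attaining operators: the restriction of `T` to every
nonzero closed subspace `M` (including `M = E`) is minimum attaining. -/
def absolutelyMinimumAttaining (E F : Type*) [NormedAddCommGroup E] [InnerProductSpace ℂ E]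
    [NormedAddCommGroup F] [InnerProductSpace ℂ F] : Set (E →L[ℂ] F) :=
  {T | ∀ M : Submodule ℂ E, IsClosed (M : Set E) → M ≠ ⊥ → IsMinimumAttaining (T.comp M.subtypeL)}

/-! What prevents attainment is a gap. Suppose `‖S x‖²` is at most `a` for unit vectors of one
infinite-dimensional subspace and at least `b > a` for those of another. Mixing orthogonal vectors
from the two yields a closed subspace on which `S` is diagonal, with squared singular values
increasing strictly to `b` or decreasing strictly to `a`; the supremum or the infimum is then
missed. An idempotent with infinite-dimensional kernel and range has the gap between 0 and 1, and
small perturbations keep a gap, which settles the closure. Conversely, if the range or the kernel is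
finite-dimensional, the operator is 0 or the identity up to finite rank, so its norms on the unit
sphere of a closed subspace already occur on a finite-dimensional one and form a compact set. -/

/-- An infinite-dimensional subspace contains a unit vector that is orthogonal to finitely many
given vectors, and whose image under `S` is orthogonal to their images. -/
theorem exists_unit_orthogonal {E F : Type*} [NormedAddCommGroup E] [InnerProductSpace ℂ E]
    [NormedAddCommGroup F] [InnerProductSpace ℂ F] (S : E →L[ℂ] F) (N : Submodule ℂ E)
    (hN : ¬ FiniteDimensional ℂ N) (W : Finset E) :
    ∃ x ∈ N, ‖x‖ = 1 ∧ ∀ w ∈ W, inner ℂ w x = 0 ∧ inner ℂ (S w) (S x) = 0 := by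
  let f : N →ₗ[ℂ] (W → ℂ) × (W → ℂ) :=
    (LinearMap.prod (LinearMap.pi fun w : W => (innerSL ℂ (w : E)).toLinearMap)
      (LinearMap.pi fun w : W => (innerSL ℂ (S w)).toLinearMap ∘ₗ S.toLinearMap)) ∘ₗ N.subtype
  have hf : ¬ Function.Injective f := fun h => hN (FiniteDimensional.of_injective f h)
  rw [← LinearMap.ker_eq_bot, Submodule.eq_bot_iff] at hf
  push Not at hf
  obtain ⟨x, hx, hx0⟩ := hf
  have hx0' : (x : E) ≠ 0 := by simpa using hx0
  have h1 : ∀ w ∈ W, inner ℂ w (x : E) = 0 := fun w hw =>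
    congrFun (congrArg Prod.fst (LinearMap.mem_ker.1 hx)) ⟨w, hw⟩
  have h2 : ∀ w ∈ W, inner ℂ (S w) (S x) = 0 := fun w hw =>
    congrFun (congrArg Prod.snd (LinearMap.mem_ker.1 hx)) ⟨w, hw⟩
  refine ⟨((‖(x : E)‖⁻¹ : ℝ) : ℂ) • (x : E), N.smul_mem _ x.2, ?_, fun w hw => ⟨?_, ?_⟩⟩
  · rw [norm_smul, Complex.norm_real, norm_inv, norm_norm]
    exact inv_mul_cancel₀ (norm_ne_zero_iff.2 hx0')
  · rw [inner_smul_right, h1 w hw, mul_zero]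
  · rw [map_smul, inner_smul_right, h2 w hw, mul_zero]

/-- The relation "orthogonal, with orthogonal images under `S`". -/
def OrthogonalAlong {E F : Type*} [NormedAddCommGroup E] [InnerProductSpace ℂ E]
    [NormedAddCommGroup F] [InnerProductSpace ℂ F] (S : E →L[ℂ] F) (x y : E) : Prop :=
  inner ℂ x y = 0 ∧ inner ℂ (S x) (S y) = 0

theorem OrthogonalAlong.add_smul {E F : Type*} [NormedAddCommGroup E] [InnerProductSpace ℂ E]
    [NormedAddCommGroup F] [InnerProductSpace ℂ F] {S : E →L[ℂ] F} {x y x' y' : E}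
    (h₁ : OrthogonalAlong S x x') (h₂ : OrthogonalAlong S x y') (h₃ : OrthogonalAlong S y x')
    (h₄ : OrthogonalAlong S y y') (a b c d : ℂ) :
    OrthogonalAlong S (a • x + b • y) (c • x' + d • y') := by
  constructor
  · simp only [inner_add_left, inner_add_right, inner_smul_left, inner_smul_right, h₁.1, h₂.1,
      h₃.1, h₄.1, mul_zero, add_zero]
  · simp only [map_add, map_smul, inner_add_left, inner_add_right, inner_smul_left,
      inner_smul_right, h₁.2, h₂.2, h₃.2, h₄.2, mul_zero, add_zero]

theorem OrthogonalAlong.symm {E F : Type*} [NormedAddCommGroup E] [InnerProductSpace ℂ E]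
    [NormedAddCommGroup F] [InnerProductSpace ℂ F] {S : E →L[ℂ] F} {x y : E}
    (h : OrthogonalAlong S x y) : OrthogonalAlong S y x :=
  ⟨inner_eq_zero_symm.1 h.1, inner_eq_zero_symm.1 h.2⟩

/-- Two infinite-dimensional subspaces contain unit sequences all of whose members are mutually
orthogonal, with mutually orthogonal images under `S`. -/
theorem exists_seq_orthogonalAlong {E F : Type*} [NormedAddCommGroup E] [InnerProductSpace ℂ E]
    [NormedAddCommGroup F] [InnerProductSpace ℂ F] (S : E →L[ℂ] F) (N R : Submodule ℂ E)
    (hN : ¬ FiniteDimensional ℂ N) (hR : ¬ FiniteDimensional ℂ R) :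
    ∃ e f : ℕ → E, (∀ n, e n ∈ N ∧ ‖e n‖ = 1) ∧ (∀ n, f n ∈ R ∧ ‖f n‖ = 1) ∧
      (∀ n, OrthogonalAlong S (e n) (f n)) ∧
      ∀ m n, m < n → OrthogonalAlong S (e m) (e n) ∧ OrthogonalAlong S (e m) (f n) ∧
        OrthogonalAlong S (f m) (e n) ∧ OrthogonalAlong S (f m) (f n) := by
  classical
  obtain ⟨p, hp, hr⟩ := exists_seq_of_forall_finset_exists
    (fun p : E × E => (p.1 ∈ N ∧ ‖p.1‖ = 1) ∧ (p.2 ∈ R ∧ ‖p.2‖ = 1) ∧ OrthogonalAlong S p.1 p.2)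
    (fun p q => OrthogonalAlong S p.1 q.1 ∧ OrthogonalAlong S p.1 q.2 ∧
      OrthogonalAlong S p.2 q.1 ∧ OrthogonalAlong S p.2 q.2) (by
    intro s _
    obtain ⟨x, hxN, hx1, hx⟩ := exists_unit_orthogonal S N hN (s.image Prod.fst ∪ s.image Prod.snd)
    obtain ⟨y, hyR, hy1, hy⟩ := exists_unit_orthogonal S R hR
      (insert x (s.image Prod.fst ∪ s.image Prod.snd))
    have h1 : ∀ p ∈ s, p.1 ∈ s.image Prod.fst ∪ s.image Prod.snd := fun p hp =>
      Finset.mem_union_left _ (Finset.mem_image_of_mem _ hp)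
    have h2 : ∀ p ∈ s, p.2 ∈ s.image Prod.fst ∪ s.image Prod.snd := fun p hp =>
      Finset.mem_union_right _ (Finset.mem_image_of_mem _ hp)
    exact ⟨(x, y), ⟨⟨hxN, hx1⟩, ⟨hyR, hy1⟩, hy x (Finset.mem_insert_self _ _)⟩, fun p hp =>
      ⟨hx _ (h1 p hp), hy _ (Finset.mem_insert_of_mem (h1 p hp)), hx _ (h2 p hp),
        hy _ (Finset.mem_insert_of_mem (h2 p hp))⟩⟩)
  exact ⟨fun n => (p n).1, fun n => (p n).2, fun n => (hp n).1, fun n => (hp n).2.1,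
    fun n => (hp n).2.2, hr⟩

theorem norm_sqrt_smul_add_sqrt_smul_sq {E : Type*} [NormedAddCommGroup E]
    [InnerProductSpace ℂ E] {x y : E} {s t : ℝ} (hs : 0 ≤ s) (ht : 0 ≤ t)
    (hxy : inner ℂ x y = 0) :
    ‖((√s : ℝ) : ℂ) • x + ((√t : ℝ) : ℂ) • y‖ ^ 2 = s * ‖x‖ ^ 2 + t * ‖y‖ ^ 2 := by
  rw [sq, norm_add_sq_eq_norm_sq_add_norm_sq_of_inner_eq_zero _ _
    (by rw [inner_smul_left, inner_smul_right, hxy]; simp), norm_smul, norm_smul,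
    Complex.norm_real, Complex.norm_real, Real.norm_of_nonneg (Real.sqrt_nonneg _),
    Real.norm_of_nonneg (Real.sqrt_nonneg _), mul_mul_mul_comm, Real.mul_self_sqrt hs,
    mul_mul_mul_comm, Real.mul_self_sqrt ht, sq, sq]

/-- If `‖S x‖² ≤ a ‖x‖²` on one infinite-dimensional subspace and `b ‖x‖² ≤ ‖S x‖²` on another
one, with `a < b`, then every sequence in `[a, b]` is the sequence of squared singular values of
`S` along some orthonormal sequence. -/
theorem exists_orthonormal_norm_sq_map_eq {E F : Type*} [NormedAddCommGroup E]
    [InnerProductSpace ℂ E] [NormedAddCommGroup F] [InnerProductSpace ℂ F] (S : E →L[ℂ] F)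
    (N R : Submodule ℂ E) (hN : ¬ FiniteDimensional ℂ N) (hR : ¬ FiniteDimensional ℂ R)
    {a b : ℝ} (hab : a < b) (ha : ∀ x ∈ N, ‖x‖ = 1 → ‖S x‖ ^ 2 ≤ a)
    (hb : ∀ x ∈ R, ‖x‖ = 1 → b ≤ ‖S x‖ ^ 2) (l : ℕ → ℝ) (hl : ∀ n, l n ∈ Set.Icc a b) :
    ∃ g : ℕ → E, Orthonormal ℂ g ∧ (∀ m n, m ≠ n → inner ℂ (S (g m)) (S (g n)) = 0) ∧
      ∀ n, ‖S (g n)‖ ^ 2 = l n := by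
  obtain ⟨e, f, he, hf, hef, h⟩ := exists_seq_orthogonalAlong S N R hN hR
  have hA : ∀ n, ‖S (e n)‖ ^ 2 ≤ a := fun n => ha _ (he n).1 (he n).2
  have hB : ∀ n, b ≤ ‖S (f n)‖ ^ 2 := fun n => hb _ (hf n).1 (hf n).2
  -- The weight for which the convex combination of the two squared norms is `l n`. Its square roots
  -- serve as coefficients in `g`, where orthogonality removes the cross terms.
  let t : ℕ → ℝ := fun n => (l n - ‖S (e n)‖ ^ 2) / (‖S (f n)‖ ^ 2 - ‖S (e n)‖ ^ 2)
  have hpos : ∀ n, 0 < ‖S (f n)‖ ^ 2 - ‖S (e n)‖ ^ 2 := fun n => by linarith [hA n, hB n]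
  have ht0 : ∀ n, 0 ≤ t n := fun n =>
    div_nonneg (by linarith [hA n, (hl n).1]) (hpos n).le
  have ht1 : ∀ n, 0 ≤ 1 - t n := fun n => by
    have : t n ≤ 1 := (div_le_one (hpos n)).2 (by linarith [hB n, (hl n).2])
    linarith
  have htl : ∀ n, (1 - t n) * ‖S (e n)‖ ^ 2 + t n * ‖S (f n)‖ ^ 2 = l n := fun n => by
    have : t n * (‖S (f n)‖ ^ 2 - ‖S (e n)‖ ^ 2) = l n - ‖S (e n)‖ ^ 2 :=
      div_mul_cancel₀ _ (hpos n).ne'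
    linarith
  let g : ℕ → E := fun n => ((√(1 - t n) : ℝ) : ℂ) • e n + ((√(t n) : ℝ) : ℂ) • f n
  have hlt : ∀ m n, m < n → OrthogonalAlong S (g m) (g n) := fun m n hmn =>
    OrthogonalAlong.add_smul (h m n hmn).1 (h m n hmn).2.1 (h m n hmn).2.2.1 (h m n hmn).2.2.2
      _ _ _ _
  have hne : ∀ m n, m ≠ n → OrthogonalAlong S (g m) (g n) := fun m n hmn =>
    hmn.lt_or_gt.elim (hlt m n) fun hnm => (hlt n m hnm).symm
  refine ⟨g, ⟨fun n => ?_, fun m n hmn => (hne m n hmn).1⟩, fun m n hmn => (hne m n hmn).2,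
    fun n => ?_⟩
  · have := norm_sqrt_smul_add_sqrt_smul_sq (ht1 n) (ht0 n) (hef n).1
    rw [(he n).2, (hf n).2] at this
    exact (sq_eq_sq₀ (norm_nonneg _) zero_le_one).1 (by rw [this]; ring)
  · rw [← htl n, ← norm_sqrt_smul_add_sqrt_smul_sq (ht1 n) (ht0 n) (hef n).2, ← map_smul, ← map_smul, ← map_add]

theorem HasSum.norm_sq_of_pairwise_orthogonal {G ι : Type*} [NormedAddCommGroup G]
    [InnerProductSpace ℂ G] {v : ι → G} {y : G} (h : HasSum v y)
    (hv : ∀ i j, i ≠ j → (inner ℂ (v i) (v j) : ℂ) = 0) :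
    HasSum (fun i => ‖v i‖ ^ 2) (‖y‖ ^ 2) := by
  classical
  refine Filter.Tendsto.congr (fun s => ?_) ((Filter.Tendsto.norm h).pow 2)
  induction s using Finset.induction_on with
  | empty => simp
  | insert i s hi ih =>
    rw [Finset.sum_insert hi, Finset.sum_insert hi, ← ih, sq, sq, sq]
    refine norm_add_sq_eq_norm_sq_add_norm_sq_of_inner_eq_zero (𝕜 := ℂ) _ _ ?_
    rw [inner_sum]
    exact Finset.sum_eq_zero fun j hj => hv i j fun hij => hi (hij ▸ hj)

/-- An orthonormal sequence with orthogonal images under `S` lies in a closed subspace on which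
`S` acts diagonally. -/
theorem exists_closed_subspace_hasSum {E F : Type*} [NormedAddCommGroup E]
    [InnerProductSpace ℂ E] [CompleteSpace E] [NormedAddCommGroup F] [InnerProductSpace ℂ F]
    (S : E →L[ℂ] F) {g : ℕ → E} (hg : Orthonormal ℂ g)
    (hS : ∀ m n, m ≠ n → inner ℂ (S (g m)) (S (g n)) = 0) :
    ∃ M : Submodule ℂ E, IsClosed (M : Set E) ∧ (∀ n, g n ∈ M) ∧
      ∀ x ∈ M, ∃ c : ℕ → ℝ, (∀ n, 0 ≤ c n) ∧ HasSum c (‖x‖ ^ 2) ∧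
        HasSum (fun n => c n * ‖S (g n)‖ ^ 2) (‖S x‖ ^ 2) := by
  classical
  -- The isometry from `ℓ²` sending the standard basis to `g`; its range is complete, hence closed.
  let V := hg.orthogonalFamily.linearIsometry
  refine ⟨LinearMap.range V.toLinearMap, ?_, fun n => ⟨lp.single 2 n 1, ?_⟩, ?_⟩
  · exact V.isometry.isUniformInducing.isComplete_range.isClosed
  · exact (hg.orthogonalFamily.linearIsometry_apply_single _).trans (by simp)
  · rintro _ ⟨f, rfl⟩
    have h : HasSum (fun n => f n • g n) (V f) := hg.orthogonalFamily.hasSum_linearIsometry f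
    refine ⟨fun n => ‖f n‖ ^ 2, fun n => sq_nonneg _, ?_, ?_⟩
    · refine (h.norm_sq_of_pairwise_orthogonal fun i j hij => ?_).congr_fun ?_
      · rw [inner_smul_left, inner_smul_right, hg.2 hij, mul_zero, mul_zero]
      · intro n
        rw [norm_smul, hg.1 n, mul_one]
    · refine ((S.hasSum h).norm_sq_of_pairwise_orthogonal fun i j hij => ?_).congr_fun ?_
      · rw [map_smul, map_smul, inner_smul_left, inner_smul_right, hS i j hij, mul_zero, mul_zero]
      · intro n
        rw [map_smul, norm_smul, mul_pow]

/-! ### A gap rules out attainment -/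

/-- For a unit vector of the diagonal subspace, `‖S x‖²` is an average of values `l n < b`, hence
below `b`, while the supremum is at least `lim l n = b`. -/
theorem notMem_absolutelyNormAttaining {E F : Type*} [NormedAddCommGroup E]
    [InnerProductSpace ℂ E] [CompleteSpace E] [NormedAddCommGroup F] [InnerProductSpace ℂ F]
    (S : E →L[ℂ] F) (N R : Submodule ℂ E) (hN : ¬ FiniteDimensional ℂ N)
    (hR : ¬ FiniteDimensional ℂ R) {a b : ℝ} (hab : a < b)
    (ha : ∀ x ∈ N, ‖x‖ = 1 → ‖S x‖ ^ 2 ≤ a) (hb : ∀ x ∈ R, ‖x‖ = 1 → b ≤ ‖S x‖ ^ 2) :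
    S ∉ absolutelyNormAttaining E F := by
  intro hS
  obtain ⟨l, -, hl, hlim⟩ := exists_seq_strictMono_tendsto' hab
  obtain ⟨g, hg, hgS, hgl⟩ := exists_orthonormal_norm_sq_map_eq S N R hN hR hab ha hb l
    fun n => ⟨(hl n).1.le, (hl n).2.le⟩
  obtain ⟨M, hM, hgM, hsum⟩ := exists_closed_subspace_hasSum S hg hgS
  obtain ⟨⟨x, hxM⟩, hx, hxS⟩ := hS M hM fun h => hg.ne_zero 0 (by simpa [h] using hgM 0)
  obtain ⟨c, hc, hcx, hcS⟩ := hsum x hxM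
  have hx1 : ‖x‖ = 1 := hx
  have hle : b ≤ ‖S x‖ ^ 2 := le_of_tendsto' hlim fun n => by
    rw [← hgl n]
    refine pow_le_pow_left₀ (norm_nonneg _) ?_ 2
    calc ‖S (g n)‖ ≤ ‖S.comp M.subtypeL‖ * ‖(⟨g n, hgM n⟩ : M)‖ :=
          (S.comp M.subtypeL).le_opNorm ⟨g n, hgM n⟩
      _ = ‖S x‖ := by
          rw [← hxS, show ‖(⟨g n, hgM n⟩ : M)‖ = 1 from hg.1 n, mul_one]; rfl
  obtain ⟨n, hn⟩ : ∃ n, c n ≠ 0 := by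
    by_contra! h
    rw [hx1, funext h] at hcx
    exact absurd (hcx.unique hasSum_zero) (by norm_num)
  have hlt : ‖S x‖ ^ 2 < ‖x‖ ^ 2 * b := by
    refine hasSum_lt (i := n) (fun k => ?_) ?_ hcS (hcx.mul_right b)
    · rw [hgl]
      exact mul_le_mul_of_nonneg_left (hl k).2.le (hc k)
    · rw [hgl]
      exact mul_lt_mul_of_pos_left (hl n).2 ((hc n).lt_of_ne' hn)
  rw [hx1] at hlt
  linarith

theorem notMem_absolutelyMinimumAttaining {E F : Type*} [NormedAddCommGroup E]
    [InnerProductSpace ℂ E] [CompleteSpace E] [NormedAddCommGroup F] [InnerProductSpace ℂ F]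
    (S : E →L[ℂ] F) (N R : Submodule ℂ E) (hN : ¬ FiniteDimensional ℂ N)
    (hR : ¬ FiniteDimensional ℂ R) {a b : ℝ} (hab : a < b)
    (ha : ∀ x ∈ N, ‖x‖ = 1 → ‖S x‖ ^ 2 ≤ a) (hb : ∀ x ∈ R, ‖x‖ = 1 → b ≤ ‖S x‖ ^ 2) :
    S ∉ absolutelyMinimumAttaining E F := by
  intro hS
  obtain ⟨l, -, hl, hlim⟩ := exists_seq_strictAnti_tendsto' hab
  obtain ⟨g, hg, hgS, hgl⟩ := exists_orthonormal_norm_sq_map_eq S N R hN hR hab ha hb l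
    fun n => ⟨(hl n).1.le, (hl n).2.le⟩
  obtain ⟨M, hM, hgM, hsum⟩ := exists_closed_subspace_hasSum S hg hgS
  obtain ⟨⟨x, hxM⟩, hx, hxS⟩ := hS M hM fun h => hg.ne_zero 0 (by simpa [h] using hgM 0)
  obtain ⟨c, hc, hcx, hcS⟩ := hsum x hxM
  have hx1 : ‖x‖ = 1 := hx
  have hle : ‖S x‖ ^ 2 ≤ a := ge_of_tendsto' hlim fun n => by
    rw [← hgl n]
    refine pow_le_pow_left₀ (norm_nonneg _) (hxS.trans_le (csInf_le ?_ ?_)) 2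
    · exact ⟨0, by rintro _ ⟨y, -, rfl⟩; exact norm_nonneg _⟩
    · exact ⟨⟨g n, hgM n⟩, hg.1 n, rfl⟩
  obtain ⟨n, hn⟩ : ∃ n, c n ≠ 0 := by
    by_contra! h
    rw [hx1, funext h] at hcx
    exact absurd (hcx.unique hasSum_zero) (by norm_num)
  have hlt : ‖x‖ ^ 2 * a < ‖S x‖ ^ 2 := by
    refine hasSum_lt (i := n) (fun k => ?_) ?_ (hcx.mul_right a) hcS
    · rw [hgl]
      exact mul_le_mul_of_nonneg_left (hl k).1.le (hc k)
    · rw [hgl]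
      exact mul_lt_mul_of_pos_left (hl n).1 ((hc n).lt_of_ne' hn)
  rw [hx1] at hlt
  linarith

/-! ### Attainment by compactness -/

/-- If `‖T (a + b)‖² = k ‖a‖² + ‖T b‖²` for all `a` in a closed subspace of finite codimension and
all `b` orthogonal to `a`, then on the unit sphere of any closed subspace `‖T x‖` takes
the same values as on the unit sphere of a finite-dimensional subspace. -/
theorem isCompact_norm_image_sphere {E F V : Type*} [NormedAddCommGroup E]
    [InnerProductSpace ℂ E] [CompleteSpace E] [NormedAddCommGroup F] [InnerProductSpace ℂ F]
    [NormedAddCommGroup V] [NormedSpace ℂ V] [FiniteDimensional ℂ V] (T : E →L[ℂ] F)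
    (P : E →L[ℂ] V) (k : ℝ)
    (hT : ∀ a b : E, P a = 0 → inner ℂ a b = 0 → ‖T (a + b)‖ ^ 2 = k * ‖a‖ ^ 2 + ‖T b‖ ^ 2)
    (M : Submodule ℂ E) (hM : IsClosed (M : Set E)) :
    IsCompact {r : ℝ | ∃ x : M, ‖x‖ = 1 ∧ ‖T.comp M.subtypeL x‖ = r} := by
  let M₀ : Submodule ℂ E := M ⊓ LinearMap.ker P.toLinearMap
  have hM₀ : IsClosed (M₀ : Set E) := hM.inter P.isClosed_ker
  have : CompleteSpace M₀ := hM₀.completeSpace_coe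
  let M₁ : Submodule ℂ E := M ⊓ M₀ᗮ
  -- `P` is injective on `M₁`: a vector of `M₁` killed by `P` lies in `M₀` and is orthogonal to
  -- itself.
  have hfin : FiniteDimensional ℂ M₁ := by
    refine FiniteDimensional.of_injective (P.toLinearMap ∘ₗ M₁.subtype) ?_
    rw [← LinearMap.ker_eq_bot, Submodule.eq_bot_iff]
    intro x hx
    have h0 : (x : E) ∈ M₀ := ⟨x.2.1, hx⟩
    exact Subtype.ext (inner_self_eq_zero.1 (x.2.2 _ h0))
  -- Only `‖a‖` enters the formula for `‖T (a + b)‖`, so one direction `u` can stand for all of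
  -- `M₀`; it is 0 when `M₀` is trivial.
  obtain ⟨u, huM, hu⟩ : ∃ u ∈ M₀, ∀ a ∈ M₀, ‖‖a‖ • u‖ = ‖a‖ := by
    by_cases h : M₀ = ⊥
    · exact ⟨0, M₀.zero_mem, fun a ha => by
        rw [h, Submodule.mem_bot] at ha; simp [ha]⟩
    · obtain ⟨v, hv, hv0⟩ := M₀.exists_mem_ne_zero_of_ne_bot h
      refine ⟨((‖v‖⁻¹ : ℝ) : ℂ) • v, M₀.smul_mem _ hv, fun a _ => ?_⟩
      rw [norm_smul, norm_smul, Complex.norm_real, norm_inv, norm_norm, norm_norm,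
        inv_mul_cancel₀ (norm_ne_zero_iff.2 hv0), mul_one]
  let W : Submodule ℂ E := M₁ ⊔ Submodule.span ℂ {u}
  have hWM : W ≤ M := sup_le inf_le_left ((Submodule.span_singleton_le_iff_mem _ _).2 huM.1)
  have hset : {r : ℝ | ∃ x : M, ‖x‖ = 1 ∧ ‖T.comp M.subtypeL x‖ = r} =
      (fun x : W => ‖T x‖) '' Metric.sphere 0 1 := by
    ext r
    constructor
    · rintro ⟨x, hx, rfl⟩
      obtain ⟨a, ha, b, hb, hxab⟩ := M₀.exists_add_mem_mem_orthogonal (x : E)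
      have hbM : b ∈ M := by
        have : b = x - a := by rw [hxab]; abel
        rw [this]
        exact M.sub_mem x.2 ha.1
      have hab : inner ℂ a b = 0 := hb a ha
      let a' : E := ‖a‖ • u
      have ha'M : a' ∈ M₀ := by
        have : a' = ((‖a‖ : ℝ) : ℂ) • u := rfl
        rw [this]
        exact M₀.smul_mem _ huM
      have hab' : inner ℂ a' b = 0 := hb a' ha'M
      have ha' : ‖a'‖ = ‖a‖ := hu a ha
      have hW : a' + b ∈ W := by
        refine add_comm b a' ▸ Submodule.add_mem_sup (⟨hbM, hb⟩ : b ∈ M₁) ?_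
        exact (Submodule.span ℂ {u}).smul_mem ((‖a‖ : ℝ) : ℂ) (Submodule.mem_span_singleton_self u)
      have hn : ‖a' + b‖ = ‖a + b‖ := by
        rw [← sq_eq_sq₀ (norm_nonneg _) (norm_nonneg _), sq, sq,
          norm_add_sq_eq_norm_sq_add_norm_sq_of_inner_eq_zero _ _ hab,
          norm_add_sq_eq_norm_sq_add_norm_sq_of_inner_eq_zero _ _ hab', ha']
      refine ⟨⟨a' + b, hW⟩, ?_, ?_⟩
      · rw [mem_sphere_zero_iff_norm]
        exact hn.trans (hxab ▸ hx)
      · change ‖T (a' + b)‖ = ‖T x‖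
        rw [← sq_eq_sq₀ (norm_nonneg _) (norm_nonneg _), hxab, hT a b ha.2 hab,
          hT a' b ha'M.2 hab', ha']
    · rintro ⟨x, hx, rfl⟩
      exact ⟨⟨x, hWM x.2⟩, mem_sphere_zero_iff_norm.1 hx, rfl⟩
  rw [hset]
  have : FiniteDimensional ℂ W := Submodule.finiteDimensional_sup _ _
  have : ProperSpace W := FiniteDimensional.proper ℂ W
  exact (isCompact_sphere _ _).image (by fun_prop)

theorem attaining_of_isCompact_norm_image_sphere {E F : Type*} [NormedAddCommGroup E]
    [InnerProductSpace ℂ E] [Nontrivial E] [NormedAddCommGroup F] [InnerProductSpace ℂ F]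
    (T : E →L[ℂ] F) (hT : IsCompact {r : ℝ | ∃ x : E, ‖x‖ = 1 ∧ ‖T x‖ = r}) :
    IsNormAttaining T ∧ IsMinimumAttaining T := by
  have hne : {r : ℝ | ∃ x : E, ‖x‖ = 1 ∧ ‖T x‖ = r}.Nonempty := by
    obtain ⟨v, hv⟩ := exists_ne (0 : E)
    refine ⟨_, ((‖v‖⁻¹ : ℝ) : ℂ) • v, ?_, rfl⟩
    rw [norm_smul, Complex.norm_real, norm_inv, norm_norm, inv_mul_cancel₀ (norm_ne_zero_iff.2 hv)]
  refine ⟨?_, hT.sInf_mem hne⟩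
  obtain ⟨_, ⟨x, hx, rfl⟩, hmax⟩ := hT.exists_isGreatest hne
  refine ⟨x, hx, le_antisymm ?_ ?_⟩
  · simpa [hx] using T.le_opNorm x
  · exact ContinuousLinearMap.opNorm_le_of_unit_norm (norm_nonneg _) fun y hy => hmax ⟨y, hy, rfl⟩

theorem mem_absolutelyAttaining_of_norm_sq_add {E F V : Type*} [NormedAddCommGroup E]
    [InnerProductSpace ℂ E] [CompleteSpace E] [NormedAddCommGroup F] [InnerProductSpace ℂ F]
    [NormedAddCommGroup V] [NormedSpace ℂ V] [FiniteDimensional ℂ V] (T : E →L[ℂ] F)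
    (P : E →L[ℂ] V) (k : ℝ)
    (hT : ∀ a b : E, P a = 0 → inner ℂ a b = 0 → ‖T (a + b)‖ ^ 2 = k * ‖a‖ ^ 2 + ‖T b‖ ^ 2) :
    T ∈ absolutelyNormAttaining E F ∧ T ∈ absolutelyMinimumAttaining E F := by
  have h : ∀ M : Submodule ℂ E, IsClosed (M : Set E) → M ≠ ⊥ →
      IsNormAttaining (T.comp M.subtypeL) ∧ IsMinimumAttaining (T.comp M.subtypeL) := by
    intro M hM hM0
    have : Nontrivial M := Submodule.nontrivial_iff_ne_bot.2 hM0
    exact attaining_of_isCompact_norm_image_sphere _ (isCompact_norm_image_sphere T P k hT M hM)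
  exact ⟨fun M hM hM0 => (h M hM hM0).1, fun M hM hM0 => (h M hM hM0).2⟩

theorem mem_absolutelyAttaining_of_finiteDimensional_range {E F : Type*} [NormedAddCommGroup E]
    [InnerProductSpace ℂ E] [CompleteSpace E] [NormedAddCommGroup F] [InnerProductSpace ℂ F]
    (T : E →L[ℂ] F) (hT : FiniteDimensional ℂ (LinearMap.range (T : E →ₗ[ℂ] F))) :
    T ∈ absolutelyNormAttaining E F ∧ T ∈ absolutelyMinimumAttaining E F := by
  refine mem_absolutelyAttaining_of_norm_sq_add T
    (T.codRestrict (LinearMap.range (T : E →ₗ[ℂ] F)) fun x => ⟨x, rfl⟩) 0 fun a b ha _ => ?_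
  have ha' : T a = 0 := congrArg Subtype.val ha
  rw [map_add, ha', zero_add, zero_mul, zero_add]

/-- Here `k = 1`. The first component of `P` makes `T` fix `a`; the second makes `a` orthogonal to
`K`, so that `T b`, which differs from `b` by a vector of `K`, stays orthogonal to `a`. -/
theorem mem_absolutelyAttaining_of_finiteDimensional_range_one_sub {E : Type*}
    [NormedAddCommGroup E] [InnerProductSpace ℂ E] [CompleteSpace E] (T : E →L[ℂ] E)
    (K : Submodule ℂ E) [FiniteDimensional ℂ K] (hK : ∀ x, x - T x ∈ K) :
    T ∈ absolutelyNormAttaining E E ∧ T ∈ absolutelyMinimumAttaining E E := by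
  refine mem_absolutelyAttaining_of_norm_sq_add T
    (((ContinuousLinearMap.id ℂ E - T).codRestrict K hK).prod K.orthogonalProjectionOnto) 1
    fun a b ha hab => ?_
  have ha1 : a - T a = 0 := congrArg Subtype.val (congrArg Prod.fst ha)
  have ha2 : a ∈ Kᗮ := Submodule.orthogonalProjectionOnto_eq_zero_iff.1 (congrArg Prod.snd ha)
  have haT : T a = a := (sub_eq_zero.1 ha1).symm
  have hb : inner ℂ a (T b) = 0 := by
    have h := K.inner_left_of_mem_orthogonal (hK b) ha2
    rw [inner_sub_right, hab, zero_sub, neg_eq_zero] at h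
    exact h
  rw [map_add, haT, sq, norm_add_sq_eq_norm_sq_add_norm_sq_of_inner_eq_zero _ _ hb]
  ring

theorem mainTheorem8 {H : Type*} [NormedAddCommGroup H] [InnerProductSpace ℂ H] [CompleteSpace H]
    (hH : ¬ FiniteDimensional ℂ H) (T : H →L[ℂ] H) (hT : IsIdempotentElem T) :
    List.TFAE [
      T ∈ absolutelyNormAttaining H H,
      FiniteDimensional ℂ (LinearMap.range (T : H →ₗ[ℂ] H)) ∨
        FiniteDimensional ℂ (LinearMap.ker (T : H →ₗ[ℂ] H)),
      T ∈ absolutelyMinimumAttaining H H,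
      T ∈ closure (absolutelyNormAttaining H H)] := by
  have hTT : ∀ x, T (T x) = T x := fun x => congrArg (fun A : H →L[ℂ] H => A x) hT.eq
  have hker : ∀ x ∈ LinearMap.ker (T : H →ₗ[ℂ] H), T x = 0 := fun x hx => hx
  have hrange : ∀ x ∈ LinearMap.range (T : H →ₗ[ℂ] H), T x = x := by
    rintro _ ⟨x, rfl⟩
    exact hTT x
  have hmem : FiniteDimensional ℂ (LinearMap.range (T : H →ₗ[ℂ] H)) ∨
      FiniteDimensional ℂ (LinearMap.ker (T : H →ₗ[ℂ] H)) →
      T ∈ absolutelyNormAttaining H H ∧ T ∈ absolutelyMinimumAttaining H H := by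
    rintro (h | h)
    · exact mem_absolutelyAttaining_of_finiteDimensional_range T h
    · refine mem_absolutelyAttaining_of_finiteDimensional_range_one_sub T
        (LinearMap.ker (T : H →ₗ[ℂ] H)) fun x => ?_
      change T (x - T x) = 0
      rw [map_sub, hTT, sub_self]
  tfae_have 1 → 4 := fun h => subset_closure h
  tfae_have 2 → 1 := fun h => (hmem h).1
  tfae_have 2 → 3 := fun h => (hmem h).2
  tfae_have 3 → 2 := by
    intro h
    by_contra! hfin
    refine notMem_absolutelyMinimumAttaining T _ _ hfin.2 hfin.1 zero_lt_one
      (fun x hx _ => ?_) (fun x hx hx1 => ?_) h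
    · rw [hker x hx, norm_zero, zero_pow two_ne_zero]
    · rw [hrange x hx, hx1, one_pow]
  tfae_have 4 → 2 := by
    intro h
    by_contra! hfin
    -- Any radius below 1/2 would do: 1/4 leaves `‖S x‖ ≤ 1/4` on the kernel and `‖S x‖ ≥ 3/4` on
    -- the range, for unit vectors.
    obtain ⟨S, hS, hTS⟩ := Metric.mem_closure_iff.1 h (1 / 4) (by norm_num)
    rw [dist_eq_norm] at hTS
    have hdist : ∀ x : H, ‖x‖ = 1 → ‖T x - S x‖ ≤ 1 / 4 := fun x hx => by
      have := (T - S).le_opNorm x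
      rw [hx, mul_one] at this
      exact this.trans hTS.le
    refine notMem_absolutelyNormAttaining S _ _ hfin.2 hfin.1
      (show ((1 : ℝ) / 4) ^ 2 < (3 / 4) ^ 2 by norm_num)
      (fun x hx hx1 => ?_) (fun x hx hx1 => ?_) hS
    · have := hdist x hx1
      rw [hker x hx, zero_sub, norm_neg] at this
      exact pow_le_pow_left₀ (norm_nonneg _) this 2
    · have h1 := hdist x hx1
      rw [hrange x hx] at h1
      have h2 := norm_sub_norm_le x (S x)
      exact pow_le_pow_left₀ (by norm_num) (by linarith) 2
  tfae_finish
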